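/- Let $P\in\mathbb R^{d\times n}$ have $\mathbb Q$-linearly independent columns, and let $\mathbb T^n=(\mathbb R/2\pi\mathbb Z)^n$ carry the normalized measure $(2\pi)^{-n}\,d\boldsymbol y$. For $r\in\mathbb R$ let $\overline H^{r}_{P,0}(\mathbb T^n)$ be the space of formal Fourier series $U=\sum_{\boldsymbol k\in\mathbb Z^n\setminus\{0\}}\widehat U_{\boldsymbol k}e^{i\boldsymbol k^\top \boldsymbol y}$, $\widehat U_{\boldsymbol k}\in\mathbb C$, with $\sum_{\boldsymbol k\ne 0}|P\boldsymbol k|^{2r}|\widehat U_{\boldsymbol k}|^2<\infty$, where $|\cdot|$ is the Euclidean norm. Let $A:\mathbb T^n\to\mathbb R$ be measurable with $0<\alpha_0\le A(\boldsymbol y)\le\alpha_1<\infty$ for all $\boldsymbol y$. Let $s\ge 0$ be real and suppose that, for some real $N>n+s+1$ and some constant $C_A>0$, the Fourier coefficients of $A$ satisfy $|\widehat A_{\boldsymbol k}|\le C_A(1+|\boldsymbol k|)^{-N}$ for all $\boldsymbol k\in\mathbb Z^n$. If $F\in\overline H^{-1}_{P,0}(\mathbb T^n)\cap\overline H^{s}_{P,0}(\mathbb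 T^n)$, then the variational problem: find $U\in\overline H^{1}_{P,0}(\mathbb T^n)$ such that $$(AP\nabla U,P\nabla V)_{L^2(\mathbb T^n)^d}=\langle F,V\rangle:=\sum_{\boldsymbol k\ne 0}\widehat F_{\boldsymbol k}\overline{\widehat V_{\boldsymbol k}}\qquad\text{for all }V\in\overline H^{1}_{P,0}(\mathbb T^n),$$ has a unique solution $U$, and $U\in\overline H^{s+2}_{P,0}(\mathbb T^n)$. Here $P\nabla U\in L^2(\mathbb T^n)^d$ is the vector field with Fourier coefficients $i\,(P\boldsymbol k)\,\widehat U_{\boldsymbol k}$. -/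

import Mathlib

open scoped ComplexConjugate
open MeasureTheory

noncomputable section

/-- The torus `𝕋ⁿ = (ℝ / 2πℤ)ⁿ`. -/
abbrev Torus (n : ℕ) : Type := Fin n → AddCircle (2 * Real.pi)

instance fact_two_pi_pos : Fact (0 < 2 * Real.pi) := ⟨Real.two_pi_pos⟩

/-- The normalized Haar measure `(2π)⁻ⁿ dy` on `𝕋ⁿ`, for which the inner product of `L²(𝕋ⁿ)` is
`∑ₖ Ûₖ conj V̂ₖ`. -/
def torusMeasure (n : ℕ) : Measure (Torus n) :=
  Measure.pi fun _ => AddCircle.haarAddCircle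

instance torusMeasure_isProbabilityMeasure (n : ℕ) : IsProbabilityMeasure (torusMeasure n) := by
  unfold torusMeasure; infer_instance

/-- The character `y ↦ exp(i kᵀy) = ∏ⱼ exp(i kⱼ yⱼ)` on `𝕋ⁿ`. -/
def torusChar {n : ℕ} (k : Fin n → ℤ) : C(Torus n, ℂ) where
  toFun y := ∏ j, fourier (k j) (y j)
  continuous_toFun := by fun_prop

/-- The Fourier coefficient `Âₖ = (2π)⁻ⁿ ∫ A(y) exp(-i kᵀy) dy` of a real function on `𝕋ⁿ`. -/
def torusFourierCoeff {n : ℕ} (A : Torus n → ℝ) (k : Fin n → ℤ) : ℂ :=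
  ∫ y, (A y : ℂ) * conj (torusChar k y) ∂torusMeasure n

/-- A formal Fourier series `∑ₖ cₖ exp(i kᵀy)` on `𝕋ⁿ`, given by its coefficients `cₖ ∈ ℂ`. -/
abbrev FourierSeries (n : ℕ) : Type := (Fin n → ℤ) → ℂ

/-- The `L²(𝕋ⁿ)` function with the given (square summable) Fourier coefficients: the sum of the
Fourier series in `L²(𝕋ⁿ)`. -/
def FourierSeries.toL2 {n : ℕ} (c : FourierSeries n) : Lp ℂ 2 (torusMeasure n) :=
  ∑' k, c k • ContinuousMap.toLp 2 (torusMeasure n) ℂ (torusChar k)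

/-- The integer frequency `k`, as a vector of Euclidean `ℝⁿ`. -/
def freq {n : ℕ} (k : Fin n → ℤ) : EuclideanSpace ℝ (Fin n) :=
  WithLp.toLp 2 fun j => (k j : ℝ)

/-- The projected frequency `P k`, as a vector of Euclidean `ℝᵈ`. -/
def projFreq {d n : ℕ} (P : Matrix (Fin d) (Fin n) ℝ) (k : Fin n → ℤ) :
    EuclideanSpace ℝ (Fin d) :=
  WithLp.toLp 2 (P.mulVec fun j => (k j : ℝ))

/-- `P` is a projection matrix: its columns are linearly independent over `ℚ`. -/
def IsProjectionMatrix {d n : ℕ} (P : Matrix (Fin d) (Fin n) ℝ) : Prop :=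
  LinearIndependent ℚ fun j : Fin n => P.col j

/-- The zero-mean homogeneous `P`-projected Sobolev space of real order `s`: the formal Fourier
series with `Û₀ = 0` and `∑_{k ≠ 0} |P k|^{2s} |Ûₖ|² < ∞`. -/
def HbarP0 {d n : ℕ} (P : Matrix (Fin d) (Fin n) ℝ) (s : ℝ) : Submodule ℂ (FourierSeries n) where
  carrier := {U | U 0 = 0 ∧
    Summable fun k : {k : Fin n → ℤ // k ≠ 0} => ‖projFreq P k‖ ^ (2 * s) * ‖U k‖ ^ 2}
  zero_mem' := by simp [summable_zero]
  add_mem' := by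
    rintro U V ⟨hU0, hU⟩ ⟨hV0, hV⟩
    refine ⟨by simp [hU0, hV0], ?_⟩
    refine Summable.of_nonneg_of_le (fun k => by positivity) (fun k => ?_)
      ((hU.add hV).mul_left 2)
    have h1 : ‖U k + V k‖ ^ 2 ≤ 2 * (‖U k‖ ^ 2 + ‖V k‖ ^ 2) := by
      have := norm_add_le (U k) (V k)
      nlinarith [norm_nonneg (U k + V k), sq_nonneg (‖U k‖ - ‖V k‖)]
    have h2 : 0 ≤ ‖projFreq P k‖ ^ (2 * s) := by positivity
    have := mul_le_mul_of_nonneg_left h1 h2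
    simp only [Pi.add_apply]
    linarith
  smul_mem' := by
    rintro a U ⟨hU0, hU⟩
    refine ⟨by simp [hU0], ?_⟩
    refine (hU.mul_left (‖a‖ ^ 2)).congr fun k => ?_
    simp only [Pi.smul_apply, smul_eq_mul, norm_mul]
    ring

/-- The `j`-th component of `P∇U`, whose Fourier coefficients are `i (P k)ⱼ Ûₖ`. -/
def projGrad {d n : ℕ} (P : Matrix (Fin d) (Fin n) ℝ) (U : FourierSeries n) (j : Fin d) :
    FourierSeries n :=
  fun k => Complex.I * (projFreq P k j : ℂ) * U k

/-- The form `a(U, V) = (A P∇U, P∇V)`, with the inner product of `L²(𝕋ⁿ)ᵈ`. -/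
def ellipticForm {d n : ℕ} (P : Matrix (Fin d) (Fin n) ℝ) (A : Torus n → ℝ)
    (U V : FourierSeries n) : ℂ :=
  ∑ j : Fin d, ∫ y, (A y : ℂ) * (projGrad P U j).toL2 y * conj ((projGrad P V j).toL2 y)
    ∂torusMeasure n

/-- The duality pairing `⟨F, V⟩ = ∑_{k ≠ 0} F̂ₖ conj V̂ₖ`. -/
def dualPairing {n : ℕ} (F V : FourierSeries n) : ℂ :=
  ∑' k : {k : Fin n → ℤ // k ≠ 0}, F k * conj (V k)

/-- `U` is a variational solution: `U` lies in the energy space (order `1`) and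
`a(U, V) = ⟨F, V⟩` for all `V` in the energy space. -/
def IsVariationalSolution {d n : ℕ} (P : Matrix (Fin d) (Fin n) ℝ) (A : Torus n → ℝ)
    (F U : FourierSeries n) : Prop :=
  U ∈ HbarP0 P 1 ∧ ∀ V ∈ HbarP0 P 1, ellipticForm P A U V = dualPairing F V

/-- The Fourier coefficients of `A` decay at the rate `N`:
`|Âₖ| ≤ C (1 + |k|)^{-N}` for all `k`, with a constant `C > 0`. -/
def HasFourierDecay {n : ℕ} (A : Torus n → ℝ) (N : ℝ) : Prop :=
  ∃ C : ℝ, 0 < C ∧ ∀ k : Fin n → ℤ, ‖torusFourierCoeff A k‖ ≤ C * (1 + ‖freq k‖) ^ (-N)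

end

/-! The coordinates `wₖ = |P k| Ûₖ` identify the energy space with `ℓ²` and turn the variational
problem into an equation `B w = f`, where `B` is coercive because `P∇` becomes an isometry and
`A ≥ α₀`. Hence `B` is bijective. The matrix of `B` is dominated by the convolution matrix `|Âₖ₋ₗ|`.

Regularity is the statement that `|P k|^(s+1) w` is square summable as soon as `|P k|^(s+1) f` is.
The commutator of `B` with the truncated weight `min(|P k|, M)^(s+1)` has entries at most a constant
times `(1 + |P(k - l)|)^(s+1) |Âₖ₋ₗ| (1 + min(|P l|, M))^s`. By Schur's test it is of order `s`
only, so interpolation absorbs it into the coercive term, with bounds independent of `M`; then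
`M → ∞`.
-/

open Filter Topology
open scoped lp ENNReal

/-! ### Real powers -/

theorem rpow_sub_rpow_le_mul {x y r : ℝ} (hx : 0 ≤ x) (hxy : x ≤ y) (hr : 1 ≤ r) :
    y ^ r - x ^ r ≤ r * (y - x) * y ^ (r - 1) := by
  rcases (hx.trans hxy).eq_or_lt with rfl | hy
  · obtain rfl : x = 0 := le_antisymm hxy hx
    simp
  have bernoulli : 1 + r * (x / y - 1) ≤ x ^ r / y ^ r := by
    have := one_add_mul_self_le_rpow_one_add (s := x / y - 1) (by linarith [div_nonneg hx hy.le]) hr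
    rwa [add_sub_cancel, Real.div_rpow hx hy.le] at this
  have hyr : y ^ r = y * y ^ (r - 1) := by
    rw [← Real.rpow_one_add' hy.le (by linarith), add_sub_cancel]
  calc y ^ r - x ^ r ≤ y ^ r - (1 + r * (x / y - 1)) * y ^ r := by
        gcongr; rwa [← le_div_iff₀ (by positivity)]
    _ = r * (y - x) * y ^ (r - 1) := by rw [hyr]; field_simp; ring

theorem abs_rpow_sub_rpow_le_mul {x y r : ℝ} (hx : 0 ≤ x) (hy : 0 ≤ y) (hr : 1 ≤ r) :
    |x ^ r - y ^ r| ≤ r * |x - y| * max x y ^ (r - 1) := by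
  wlog hxy : y ≤ x generalizing x y
  · rw [abs_sub_comm, abs_sub_comm x, max_comm]
    exact this hy hx (le_of_not_ge hxy)
  rw [max_eq_left hxy, abs_of_nonneg (sub_nonneg.2 hxy), abs_of_nonneg (sub_nonneg.2 (by gcongr))]
  exact rpow_sub_rpow_le_mul hy hxy hr

theorem abs_rpow_add_one_sub_le {x y q s : ℝ} (hx : 0 ≤ x) (hy : 0 ≤ y) (hs : 0 ≤ s)
    (hxy : |x - y| ≤ q) :
    |x ^ (s + 1) - y ^ (s + 1)| ≤ (s + 1) * (1 + q) ^ (s + 1) * (1 + y) ^ s := by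
  have hq : 0 ≤ q := (abs_nonneg _).trans hxy
  have hmax : max x y ≤ (1 + q) * (1 + y) := by
    have := (le_abs_self (x - y)).trans hxy
    apply max_le <;> nlinarith
  calc |x ^ (s + 1) - y ^ (s + 1)| ≤ (s + 1) * |x - y| * max x y ^ s := by
        simpa using abs_rpow_sub_rpow_le_mul hx hy (r := s + 1) (by linarith)
    _ ≤ (s + 1) * (1 + q) * ((1 + q) * (1 + y)) ^ s := by gcongr; linarith
    _ = (s + 1) * (1 + q) ^ (s + 1) * (1 + y) ^ s := by
        rw [Real.mul_rpow (by positivity) (by positivity), Real.rpow_add_one (by positivity)]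
        ring

theorem exists_one_add_rpow_le_mul_rpow_add_one {s δ : ℝ} (hs : 0 ≤ s) (hδ : 0 < δ) :
    ∃ C, 0 ≤ C ∧ ∀ x : ℝ, 0 ≤ x → (1 + x) ^ s ≤ δ * x ^ (s + 1) + C := by
  set R := max 1 (2 ^ s / δ)
  have hR : 2 ^ s ≤ δ * R := (div_le_iff₀' hδ).1 (le_max_right _ _)
  refine ⟨(1 + R) ^ s, by positivity, fun x hx => ?_⟩
  rcases le_total x R with hxR | hxR
  · have : (1 + x) ^ s ≤ (1 + R) ^ s := by gcongr
    have : 0 ≤ δ * x ^ (s + 1) := by positivity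
    linarith
  · have hx1 : 1 ≤ x := (le_max_left _ _).trans hxR
    calc (1 + x) ^ s ≤ (2 * x) ^ s := by gcongr; linarith
      _ = 2 ^ s * x ^ s := Real.mul_rpow zero_le_two hx
      _ ≤ δ * x * x ^ s := by gcongr; exact hR.trans (by gcongr)
      _ = δ * x ^ (s + 1) := by rw [Real.rpow_add_one (by positivity)]; ring
      _ ≤ δ * x ^ (s + 1) + (1 + R) ^ s := le_add_of_nonneg_right (by positivity)

/-! ### Convolution kernels on `ℓ²` -/

theorem sq_tsum_mul_le {ι : Type*} {κ z : ι → ℝ} (hκ0 : ∀ i, 0 ≤ κ i) (hκ : Summable κ)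
    (hκz : Summable fun i => κ i * z i ^ 2) :
    (∑' i, κ i * z i) ^ 2 ≤ (∑' i, κ i) * ∑' i, κ i * z i ^ 2 := by
  have hsum : Summable fun i => κ i * z i := by
    refine .of_norm_bounded (hκ.add hκz) fun i => ?_
    rw [Real.norm_eq_abs, abs_mul, abs_of_nonneg (hκ0 i)]
    nlinarith [hκ0 i, mul_nonneg (hκ0 i) (sq_nonneg (|z i| - 1)), sq_abs (z i), abs_nonneg (z i)]
  refine le_of_tendsto_of_tendsto' (Tendsto.pow hsum.hasSum 2)
    (Tendsto.mul hκ.hasSum hκz.hasSum) fun t => ?_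
  exact Finset.sum_sq_le_sum_mul_sum_of_sq_le_mul t (fun i _ => hκ0 i)
    (fun i _ => mul_nonneg (hκ0 i) (sq_nonneg _)) fun i _ => le_of_eq (by ring)

section ConvolutionKernel

variable {G ι E F : Type*} [AddCommGroup G] [NormedAddCommGroup E] [NormedAddCommGroup F]
  {κ : G → ℝ} {j : ι → G}

theorem hasSum_norm_sq (w : ℓ²(ι, E)) : HasSum (fun i => ‖w i‖ ^ 2) (‖w‖ ^ 2) := by
  simpa using lp.hasSum_norm (p := 2) (by norm_num) w

theorem summable_kernel_mul_norm (hκ : Summable κ) (hj : j.Injective) (z : ℓ²(ι, F)) (k : ι) :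
    Summable fun l => κ (j k - j l) * ‖z l‖ := by
  have hinj : Function.Injective fun l => j k - j l := fun _ _ h => hj (sub_right_injective h)
  refine .of_norm_bounded ((hκ.comp_injective hinj).norm.mul_right ‖z‖) fun l => ?_
  rw [norm_mul, norm_norm]
  exact mul_le_mul_of_nonneg_left (lp.norm_apply_le_norm two_ne_zero z l) (norm_nonneg _)

theorem summable_kernel_mul (hκ0 : ∀ g, 0 ≤ κ g) (hκ : Summable κ) (hj : j.Injective)
    {y : ι → ℝ} (hy0 : ∀ i, 0 ≤ y i) (hy : Summable y) :
    Summable (fun q : ι × ι => κ (j q.1 - j q.2) * y q.2) ∧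
      ∑' q : ι × ι, κ (j q.1 - j q.2) * y q.2 ≤ (∑' g, κ g) * ∑' i, y i := by
  have hinj : Function.Injective fun q : ι × ι => (j q.1 - j q.2, q.2) := by
    rintro ⟨a, b⟩ ⟨c, d⟩ h
    simp only [Prod.mk.injEq] at h
    obtain ⟨h, rfl⟩ := h
    rw [hj (sub_left_injective h)]
  have hs : Summable fun q : G × ι => κ q.1 * y q.2 := hκ.mul_of_nonneg hy hκ0 hy0
  refine ⟨hs.comp_injective hinj, ?_⟩
  rw [hκ.tsum_mul_tsum hy hs]
  exact tsum_comp_le_tsum_of_inj hs (fun q => mul_nonneg (hκ0 _) (hy0 _)) hinj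

/-- Schur's test for a convolution kernel: `ℓ¹ * ℓ² ⊆ ℓ²`. -/
theorem norm_le_of_norm_apply_le_tsum_kernel (hκ0 : ∀ g, 0 ≤ κ g) (hκ : Summable κ)
    (hj : j.Injective) {v : ℓ²(ι, E)} {z : ℓ²(ι, F)}
    (h : ∀ k, ‖v k‖ ≤ ∑' l, κ (j k - j l) * ‖z l‖) : ‖v‖ ≤ (∑' g, κ g) * ‖z‖ := by
  have hK : 0 ≤ ∑' g, κ g := tsum_nonneg hκ0
  obtain ⟨hs, hle⟩ :=
    summable_kernel_mul hκ0 hκ hj (fun _ => sq_nonneg _) (hasSum_norm_sq z).summable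
  have row (k : ι) : ‖v k‖ ^ 2 ≤ (∑' g, κ g) * ∑' l, κ (j k - j l) * ‖z l‖ ^ 2 := by
    have hinj : Function.Injective fun l => j k - j l := fun _ _ h => hj (sub_right_injective h)
    calc ‖v k‖ ^ 2 ≤ (∑' l, κ (j k - j l) * ‖z l‖) ^ 2 := by gcongr; exact h k
      _ ≤ (∑' l, κ (j k - j l)) * ∑' l, κ (j k - j l) * ‖z l‖ ^ 2 :=
        sq_tsum_mul_le (fun _ => hκ0 _) (hκ.comp_injective hinj) (hs.prod_factor k)
      _ ≤ (∑' g, κ g) * ∑' l, κ (j k - j l) * ‖z l‖ ^ 2 := by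
        gcongr
        · exact tsum_nonneg fun l => mul_nonneg (hκ0 _) (sq_nonneg _)
        · exact tsum_comp_le_tsum_of_inj hκ hκ0 hinj
  refine le_of_sq_le_sq ?_ (by positivity)
  calc ‖v‖ ^ 2 = ∑' k, ‖v k‖ ^ 2 := (hasSum_norm_sq v).tsum_eq.symm
    _ ≤ ∑' k, (∑' g, κ g) * ∑' l, κ (j k - j l) * ‖z l‖ ^ 2 :=
      (hasSum_norm_sq v).summable.tsum_le_tsum row (hs.prod.mul_left _)
    _ = (∑' g, κ g) * ∑' q : ι × ι, κ (j q.1 - j q.2) * ‖z q.2‖ ^ 2 := by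
      rw [tsum_mul_left, hs.tsum_prod]
    _ ≤ (∑' g, κ g) * ((∑' g, κ g) * ∑' l, ‖z l‖ ^ 2) := by gcongr
    _ = ((∑' g, κ g) * ‖z‖) ^ 2 := by rw [(hasSum_norm_sq z).tsum_eq]; ring

end ConvolutionKernel

/-! ### Regularity for operators on `ℓ²` with off-diagonal decay -/

section DiagonalOperator

variable {ι : Type*}

/-- The operator on `ℓ²` multiplying the `i`-th entry by `m i`, for a bounded sequence `m`. Fourier
multipliers and the truncated weights of the regularity argument are of this form. -/
noncomputable def diagonalOp (m : ℓ^∞(ι, ℂ)) : ℓ²(ι, ℂ) →L[ℂ] ℓ²(ι, ℂ) :=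
  lp.holderL (p := ∞) (q := 2) 2 (K := 1) (fun _ => ContinuousLinearMap.mul ℂ ℂ)
    (fun _ => ContinuousLinearMap.opNorm_mul_le ℂ ℂ) m

@[simp]
theorem diagonalOp_apply (m : ℓ^∞(ι, ℂ)) (w : ℓ²(ι, ℂ)) (i : ι) : diagonalOp m w i = m i * w i :=
  rfl

theorem norm_diagonalOp_le_of_bounded_below {B : ℓ²(ι, ℂ) →L[ℂ] ℓ²(ι, ℂ)}
    {m : ℓ^∞(ι, ℂ)} {α δ C K : ℝ} (hα : ∀ w, α * ‖w‖ ≤ ‖B w‖) {w : ℓ²(ι, ℂ)}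
    (hcomm : ‖diagonalOp m (B w) - B (diagonalOp m w)‖ ≤ K * (δ * ‖diagonalOp m w‖ + C * ‖w‖))
    (hδ : K * δ ≤ α / 2) :
    α / 2 * ‖diagonalOp m w‖ ≤ ‖diagonalOp m (B w)‖ + K * C * ‖w‖ := by
  have habsorb := mul_le_mul_of_nonneg_right hδ (norm_nonneg (diagonalOp m w))
  have hBm := norm_le_norm_add_norm_sub (diagonalOp m (B w)) (B (diagonalOp m w))
  linarith [hα (diagonalOp m w)]

variable [DecidableEq ι]

theorem inner_single_one (k : ι) (w : ℓ²(ι, ℂ)) :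
    inner ℂ (lp.single (E := fun _ : ι => ℂ) 2 k 1) w = w k :=
  (lp.inner_single_left k 1 w).trans (by simp)

theorem hasSum_apply_single_mul (B : ℓ²(ι, ℂ) →L[ℂ] ℓ²(ι, ℂ)) (w : ℓ²(ι, ℂ)) (k : ι) :
    HasSum (fun l => B (lp.single 2 l 1) k * w l) (B w k) := by
  refine ((lp.evalCLM ℂ (fun _ : ι => ℂ) 2 k ∘L B).hasSum
    (lp.hasSum_single ENNReal.ofNat_ne_top w)).congr_fun fun l => ?_
  have : lp.single (E := fun _ : ι => ℂ) 2 l (w l) = w l • lp.single 2 l 1 := by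
    rw [← lp.single_smul, smul_eq_mul, mul_one]
  simp [this, mul_comm, lp.evalCLM]

variable {G : Type*} [AddCommGroup G] {κ : G → ℝ} {j : ι → G} {B : ℓ²(ι, ℂ) →L[ℂ] ℓ²(ι, ℂ)}
  {m : ℓ^∞(ι, ℂ)} {δ C : ℝ}

/-- The commutator has matrix entries `(m k - m l) Bₖₗ`, to which Schur's test applies. -/
theorem norm_diagonalOp_apply_sub_le (hκ0 : ∀ g, 0 ≤ κ g) (hκ : Summable κ) (hj : j.Injective)
    (hδ : 0 ≤ δ) (hC : 0 ≤ C)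
    (hB : ∀ k l, ‖m k - m l‖ * ‖B (lp.single 2 l 1) k‖ ≤ κ (j k - j l) * (δ * ‖m l‖ + C))
    (w : ℓ²(ι, ℂ)) :
    ‖diagonalOp m (B w) - B (diagonalOp m w)‖ ≤ (∑' g, κ g) * (δ * ‖diagonalOp m w‖ + C * ‖w‖) := by
  set z : ℓ²(ι, ℝ) := δ • lp.toNorm (diagonalOp m w) + C • lp.toNorm w
  have hz (l : ι) : ‖z l‖ = (δ * ‖m l‖ + C) * ‖w l‖ := by
    have : z l = (δ * ‖m l‖ + C) * ‖w l‖ := by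
      change δ * ‖m l * w l‖ + C * ‖w l‖ = _
      rw [norm_mul]; ring
    rw [this, Real.norm_of_nonneg (by positivity)]
  have hznorm : ‖z‖ ≤ δ * ‖diagonalOp m w‖ + C * ‖w‖ := by
    refine (norm_add_le _ _).trans_eq ?_
    rw [norm_smul, norm_smul, lp.norm_toNorm, lp.norm_toNorm, Real.norm_of_nonneg hδ,
      Real.norm_of_nonneg hC]
  have commutator_apply (k : ι) : HasSum (fun l => (m k - m l) * B (lp.single 2 l 1) k * w l)
      ((diagonalOp m (B w) - B (diagonalOp m w)) k) := by
    refine (((hasSum_apply_single_mul B w k).mul_left (m k)).sub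
      (hasSum_apply_single_mul B (diagonalOp m w) k)).congr_fun fun l => ?_
    rw [diagonalOp_apply]; ring
  refine (norm_le_of_norm_apply_le_tsum_kernel hκ0 hκ hj fun k => ?_).trans
    (mul_le_mul_of_nonneg_left hznorm (tsum_nonneg hκ0))
  rw [← (commutator_apply k).tsum_eq]
  refine tsum_of_norm_bounded (summable_kernel_mul_norm hκ hj z k).hasSum fun l => ?_
  rw [norm_mul, norm_mul, hz, ← mul_assoc]
  exact mul_le_mul_of_nonneg_right (hB k l) (norm_nonneg _)

end DiagonalOperator

section TruncatedWeight

variable {ι E : Type*} [NormedAddCommGroup E] {r : ℝ}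

/-- The bounded weights `min (‖x i‖, M) ^ r`, increasing to `‖x i‖ ^ r` as `M → ∞`. -/
noncomputable def truncatedWeight (x : ι → E) (hr : 0 ≤ r) (M : ℕ) : ℓ^∞(ι, ℂ) :=
  ⟨fun i => ((min ‖x i‖ M ^ r : ℝ) : ℂ), memℓp_infty ⟨(M : ℝ) ^ r, by
    rintro _ ⟨i, rfl⟩
    refine (Complex.norm_real _).trans_le ?_
    rw [Real.norm_of_nonneg (by positivity)]
    gcongr
    exact min_le_right _ _⟩⟩

theorem truncatedWeight_apply (x : ι → E) (hr : 0 ≤ r) (M : ℕ) (i : ι) :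
    truncatedWeight x hr M i = ((min ‖x i‖ M ^ r : ℝ) : ℂ) :=
  rfl

theorem norm_truncatedWeight_apply (x : ι → E) (hr : 0 ≤ r) (M : ℕ) (i : ι) :
    ‖truncatedWeight x hr M i‖ = min ‖x i‖ M ^ r := by
  rw [truncatedWeight_apply, Complex.norm_real, Real.norm_of_nonneg (by positivity)]

theorem truncatedWeight_eventuallyEq (x : ι → E) (hr : 0 ≤ r) (i : ι) :
    ∀ᶠ M in atTop, truncatedWeight x hr M i = ((‖x i‖ ^ r : ℝ) : ℂ) := by
  filter_upwards [tendsto_natCast_atTop_atTop.eventually_ge_atTop ‖x i‖] with M hM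
  rw [truncatedWeight_apply, min_eq_left hM]

theorem norm_diagonalOp_truncatedWeight_le (x : ι → E) (hr : 0 ≤ r) (M : ℕ) {w g : ℓ²(ι, ℂ)}
    (hg : ∀ i, g i = ((‖x i‖ ^ r : ℝ) : ℂ) * w i) :
    ‖diagonalOp (truncatedWeight x hr M) w‖ ≤ ‖g‖ := by
  refine lp.norm_mono two_ne_zero fun i => ?_
  rw [diagonalOp_apply, hg, norm_mul, norm_mul, norm_truncatedWeight_apply, Complex.norm_real,
    Real.norm_of_nonneg (by positivity)]
  gcongr
  exact min_le_left _ _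

theorem memℓp_of_norm_diagonalOp_truncatedWeight_le (x : ι → E) (hr : 0 ≤ r) {w : ℓ²(ι, ℂ)} {R : ℝ}
    (hR : ∀ M, ‖diagonalOp (truncatedWeight x hr M) w‖ ≤ R) :
    Memℓp (fun i => ((‖x i‖ ^ r : ℝ) : ℂ) * w i) 2 := by
  refine lp.memℓp_of_tendsto (l := atTop) (F := fun M => diagonalOp (truncatedWeight x hr M) w)
    (isBounded_iff_forall_norm_le.2 ⟨R, Set.forall_mem_range.2 hR⟩) (tendsto_pi_nhds.2 fun i => ?_)
  refine tendsto_const_nhds.congr' ?_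
  filter_upwards [truncatedWeight_eventuallyEq x hr i] with M hM
  rw [id, diagonalOp_apply, hM]

variable {s : ℝ}

theorem norm_truncatedWeight_sub_le (x : ι → E) (hs : 0 ≤ s) (hs' : 0 ≤ s + 1) (M : ℕ) (k l : ι) :
    ‖truncatedWeight x hs' M k - truncatedWeight x hs' M l‖ ≤
      (s + 1) * (1 + ‖x k - x l‖) ^ (s + 1) * (1 + min ‖x l‖ M) ^ s := by
  rw [truncatedWeight_apply, truncatedWeight_apply, ← Complex.ofReal_sub, Complex.norm_real]
  refine abs_rpow_add_one_sub_le (by positivity) (by positivity) hs ?_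
  calc |min ‖x k‖ M - min ‖x l‖ M| ≤ max |‖x k‖ - ‖x l‖| |(M : ℝ) - M| :=
        abs_min_sub_min_le_max ..
    _ ≤ ‖x k - x l‖ := by simpa using abs_norm_sub_norm_le (x k) (x l)

variable {G : Type*} [AddCommGroup G] [DecidableEq ι] {j : ι → G} {B : ℓ²(ι, ℂ) →L[ℂ] ℓ²(ι, ℂ)}

/-- The truncated weight commutes with `B` up to terms of order `s`, which are absorbed uniformly
in the truncation. -/
theorem memℓp_norm_rpow_mul_of_apply {α : ℝ} (hα : 0 < α) (hB : ∀ w, α * ‖w‖ ≤ ‖B w‖)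
    (hs : 0 ≤ s) (x : G →+ E) (hj : j.Injective) {a : G → ℂ}
    (ha : Summable fun g => (1 + ‖x g‖) ^ (s + 1) * ‖a g‖)
    (hBa : ∀ k l, ‖B (lp.single 2 l 1) k‖ ≤ ‖a (j k - j l)‖) {w : ℓ²(ι, ℂ)}
    (hw : Memℓp (fun i => ((‖x (j i)‖ ^ (s + 1) : ℝ) : ℂ) * B w i) 2) :
    Memℓp (fun i => ((‖x (j i)‖ ^ (s + 1) : ℝ) : ℂ) * w i) 2 := by
  have hs' : 0 ≤ s + 1 := by linarith
  set κ : G → ℝ := fun g => (s + 1) * ((1 + ‖x g‖) ^ (s + 1) * ‖a g‖)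
  have hκ0 (g) : 0 ≤ κ g := by positivity
  set K := ∑' g, κ g
  have : 0 ≤ K := tsum_nonneg hκ0
  obtain ⟨C, hC, interpolation⟩ := exists_one_add_rpow_le_mul_rpow_add_one (δ := α / (2 * (K + 1)))
    hs (by positivity)
  have hentries (M : ℕ) (k l : ι) :
      ‖truncatedWeight (x ∘ j) hs' M k - truncatedWeight (x ∘ j) hs' M l‖ *
          ‖B (lp.single 2 l 1) k‖ ≤
        κ (j k - j l) * (α / (2 * (K + 1)) * ‖truncatedWeight (x ∘ j) hs' M l‖ + C) := by
    have hM : 0 ≤ min ‖x (j l)‖ M := by positivity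
    rw [norm_truncatedWeight_apply]
    calc _ ≤ (s + 1) * (1 + ‖x (j k) - x (j l)‖) ^ (s + 1) * (1 + min ‖x (j l)‖ M) ^ s *
          ‖a (j k - j l)‖ := by
            gcongr
            exacts [norm_truncatedWeight_sub_le (x ∘ j) hs hs' M k l, hBa k l]
      _ = κ (j k - j l) * (1 + min ‖x (j l)‖ M) ^ s := by simp only [κ, map_sub]; ring
      _ ≤ _ := mul_le_mul_of_nonneg_left (interpolation _ hM) (hκ0 _)
  refine memℓp_of_norm_diagonalOp_truncatedWeight_le (x ∘ j) hs'
    (R := (‖(⟨_, hw⟩ : ℓ²(ι, ℂ))‖ + K * C * ‖w‖) / (α / 2)) fun M => ?_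
  rw [le_div_iff₀' (by positivity)]
  have hcomm := norm_diagonalOp_apply_sub_le hκ0 (ha.mul_left _) hj (by positivity) hC
    (hentries M) w
  have habsorb : K * (α / (2 * (K + 1))) ≤ α / 2 := by
    rw [mul_div_assoc', div_le_div_iff₀ (by positivity) two_pos]
    linarith
  refine (norm_diagonalOp_le_of_bounded_below hB hcomm habsorb).trans ?_
  gcongr
  exact norm_diagonalOp_truncatedWeight_le (x ∘ j) hs' M fun i => rfl

end TruncatedWeight

section Coercive

variable {H : Type*} [NormedAddCommGroup H] [InnerProductSpace ℂ H] {B : H →L[ℂ] H} {α : ℝ}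

theorem mul_norm_le_of_coercive (hB : ∀ w, α * ‖w‖ ^ 2 ≤ (inner ℂ w (B w)).re) (w : H) :
    α * ‖w‖ ≤ ‖B w‖ := by
  rcases (norm_nonneg w).eq_or_lt with hw | hw
  · simp [← hw]
  refine le_of_mul_le_mul_left ?_ hw
  calc ‖w‖ * (α * ‖w‖) = α * ‖w‖ ^ 2 := by ring
    _ ≤ (inner ℂ w (B w)).re := hB w
    _ ≤ ‖w‖ * ‖B w‖ := (Complex.re_le_norm _).trans (norm_inner_le_norm _ _)

theorem bijective_of_coercive [CompleteSpace H] (hα : 0 < α)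
    (hB : ∀ w, α * ‖w‖ ^ 2 ≤ (inner ℂ w (B w)).re) : Function.Bijective B := by
  rw [← ContinuousLinearMap.isUnit_iff_bijective]
  refine ContinuousLinearMap.isUnit_of_forall_le_norm_inner_map B (c := ⟨α, hα.le⟩) hα fun w => ?_
  rw [norm_inner_symm, mul_comm]
  exact (hB w).trans (Complex.re_le_norm _)

end Coercive

/-! ### Multiplication operators and characters on `L²(𝕋ⁿ)` -/

section Multiplication

variable {X : Type*} [MeasurableSpace X] {μ : Measure X}

/-- The operator of multiplication by `a ∈ L^∞` on `L²`. -/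
noncomputable def mulL2 (a : Lp ℂ ∞ μ) : Lp ℂ 2 μ →L[ℂ] Lp ℂ 2 μ :=
  (ContinuousLinearMap.mul ℂ ℂ).holderL μ ∞ 2 2 a

theorem coeFn_mulL2 (a : Lp ℂ ∞ μ) (f : Lp ℂ 2 μ) : mulL2 a f =ᵐ[μ] fun y => a y * f y :=
  (ContinuousLinearMap.mul ℂ ℂ).coeFn_holder (r := 2) a f

theorem inner_mulL2 (a : Lp ℂ ∞ μ) (f g : Lp ℂ 2 μ) :
    inner ℂ g (mulL2 a f) = ∫ y, a y * f y * conj (g y) ∂μ := by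
  rw [L2.inner_def]
  refine integral_congr_ae ?_
  filter_upwards [coeFn_mulL2 a f] with y hy
  rw [hy, RCLike.inner_apply]

theorem re_inner_L2 (f g : Lp ℂ 2 μ) : (inner ℂ f g).re = ∫ y, (inner ℂ (f y) (g y)).re ∂μ := by
  rw [L2.inner_def]
  exact (integral_re (L2.integrable_inner (𝕜 := ℂ) f g)).symm

theorem mul_norm_sq_le_re_inner_mulL2 {a : Lp ℂ ∞ μ} {α : ℝ} (ha : ∀ᵐ y ∂μ, α ≤ (a y).re)
    (f : Lp ℂ 2 μ) : α * ‖f‖ ^ 2 ≤ (inner ℂ f (mulL2 a f)).re := by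
  rw [← inner_self_eq_norm_sq (𝕜 := ℂ) f]
  change α * (inner ℂ f f).re ≤ _
  rw [re_inner_L2, re_inner_L2, ← integral_const_mul]
  refine integral_mono_ae ((L2.integrable_inner (𝕜 := ℂ) f f).re.const_mul α)
    (L2.integrable_inner (𝕜 := ℂ) f (mulL2 a f)).re ?_
  filter_upwards [ha, coeFn_mulL2 a f] with y hαy hy
  have hfy : (inner ℂ (f y) (f y)).re = ‖f y‖ ^ 2 := inner_self_eq_norm_sq (𝕜 := ℂ) (f y)
  have hafy : (inner ℂ (f y) (mulL2 a f y)).re = (a y).re * ‖f y‖ ^ 2 := by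
    rw [hy, RCLike.inner_apply, mul_assoc, Complex.mul_conj', ← Complex.ofReal_pow,
      Complex.re_mul_ofReal]
  change α * (inner ℂ (f y) (f y)).re ≤ (inner ℂ (f y) (mulL2 a f y)).re
  rw [hfy, hafy]
  gcongr

theorem exists_ae_eq_ofReal_and_le_re {A : X → ℝ} (hA : AEMeasurable A μ) {α₀ α₁ : ℝ}
    (hbound : ∀ᵐ y ∂μ, α₀ ≤ A y ∧ A y ≤ α₁) :
    ∃ a : Lp ℂ ∞ μ, (a =ᵐ[μ] fun y => (A y : ℂ)) ∧ ∀ᵐ y ∂μ, α₀ ≤ (a y).re := by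
  have hmem : MemLp (fun y => (A y : ℂ)) ∞ μ := by
    refine memLp_top_of_bound
      (Complex.measurable_ofReal.comp_aemeasurable hA).aestronglyMeasurable (max |α₀| |α₁|) ?_
    filter_upwards [hbound] with y hy
    rw [Complex.norm_real]
    exact abs_le_max_abs_abs hy.1 hy.2
  refine ⟨hmem.toLp _, hmem.coeFn_toLp, ?_⟩
  filter_upwards [hmem.coeFn_toLp, hbound] with y hy hα
  rw [hy, Complex.ofReal_re]
  exact hα.1

end Multiplication

section Characters

variable {n : ℕ}

/-- The character `exp(i kᵀy)` as an element of `L²(𝕋ⁿ)`. -/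
noncomputable def charL2 (k : Fin n → ℤ) : Lp ℂ 2 (torusMeasure n) :=
  ContinuousMap.toLp 2 (torusMeasure n) ℂ (torusChar k)

theorem coeFn_charL2 (k : Fin n → ℤ) : charL2 k =ᵐ[torusMeasure n] torusChar k :=
  ContinuousMap.coeFn_toLp _ _

theorem conj_torusChar (k : Fin n → ℤ) (y : Torus n) : conj (torusChar k y) = torusChar (-k) y := by
  simp only [torusChar, ContinuousMap.coe_mk, map_prod, ← fourier_neg, Pi.neg_apply]

theorem torusChar_mul_conj (k l : Fin n → ℤ) (y : Torus n) :
    torusChar k y * conj (torusChar l y) = torusChar (k - l) y := by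
  simp only [torusChar, ContinuousMap.coe_mk, map_prod, ← fourier_neg, ← Finset.prod_mul_distrib,
    ← fourier_add, sub_eq_add_neg, Pi.add_apply, Pi.neg_apply]

theorem integral_torusChar (k : Fin n → ℤ) :
    ∫ y, torusChar k y ∂torusMeasure n = if k = 0 then 1 else 0 := by
  split_ifs with hk
  · simp [hk, torusChar]
  · obtain ⟨i, hi : k i ≠ 0⟩ := Function.ne_iff.mp hk
    simp only [torusChar, ContinuousMap.coe_mk, torusMeasure]
    rw [integral_fintype_prod_eq_prod (f := fun j y => fourier (k j) y)]
    refine Finset.prod_eq_zero (Finset.mem_univ i) ?_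
    simpa [hi.symm, ContinuousMap.inner_toLp] using
      (orthonormal_iff_ite.mp <| orthonormal_fourier (T := 2 * Real.pi)) 0 (k i)

theorem orthonormal_charL2 : Orthonormal ℂ (charL2 (n := n)) := by
  classical
  rw [orthonormal_iff_ite]
  intro k l
  simp only [charL2, ContinuousMap.inner_toLp, torusChar_mul_conj, integral_torusChar,
    sub_eq_zero, eq_comm]

theorem inner_charL2_mulL2_charL2 {A : Torus n → ℝ} {a : Lp ℂ ∞ (torusMeasure n)}
    (ha : a =ᵐ[torusMeasure n] fun y => (A y : ℂ)) (k l : Fin n → ℤ) :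
    inner ℂ (charL2 k) (mulL2 a (charL2 l)) = torusFourierCoeff A (k - l) := by
  rw [inner_mulL2, torusFourierCoeff]
  refine integral_congr_ae ?_
  filter_upwards [ha, coeFn_charL2 k, coeFn_charL2 l] with y hy hk hl
  rw [hy, hk, hl, mul_assoc, torusChar_mul_conj, conj_torusChar, neg_sub]

/-- The index set of a zero-mean Fourier series. -/
abbrev NonzeroFreq (n : ℕ) : Type := {k : Fin n → ℤ // k ≠ 0}

theorem orthonormal_charL2_nonzero : Orthonormal ℂ fun k : NonzeroFreq n => charL2 k.1 :=
  orthonormal_charL2.comp _ Subtype.val_injective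

/-- The zero-mean function in `L²(𝕋ⁿ)` with the given Fourier coefficients. -/
noncomputable def fourierSynthesis (n : ℕ) :
    ℓ²(NonzeroFreq n, ℂ) →ₗᵢ[ℂ] Lp ℂ 2 (torusMeasure n) :=
  orthonormal_charL2_nonzero.orthogonalFamily.linearIsometry

theorem hasSum_fourierSynthesis (w : ℓ²(NonzeroFreq n, ℂ)) :
    HasSum (fun k : NonzeroFreq n => w k • charL2 k.1) (fourierSynthesis n w) :=
  orthonormal_charL2_nonzero.orthogonalFamily.hasSum_linearIsometry w

theorem fourierSynthesis_single (k : NonzeroFreq n) (c : ℂ) :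
    fourierSynthesis n (lp.single 2 k c) = c • charL2 k.1 :=
  orthonormal_charL2_nonzero.orthogonalFamily.linearIsometry_apply_single c

theorem toL2_eq_fourierSynthesis {c : FourierSeries n} (hc : c 0 = 0) {w : ℓ²(NonzeroFreq n, ℂ)}
    (hw : ∀ k, w k = c k) : c.toL2 = fourierSynthesis n w := by
  have h : HasSum (fun k : NonzeroFreq n => c k • charL2 k.1) (fourierSynthesis n w) :=
    (hasSum_fourierSynthesis w).congr_fun fun k => by rw [hw]
  have h' : HasSum (fun k => c k • charL2 k) (fourierSynthesis n w) := by
    refine (Function.Injective.hasSum_iff Subtype.val_injective fun k hk => ?_).1 h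
    have hk0 : k = 0 := by
      by_contra h
      exact hk ⟨⟨k, h⟩, rfl⟩
    rw [hk0, hc, zero_smul]
  exact h'.tsum_eq

end Characters

/-! ### Projected frequencies -/

section ProjFreq

variable {d n : ℕ} {P : Matrix (Fin d) (Fin n) ℝ}

theorem projFreq_sub (k l : Fin n → ℤ) : projFreq P (k - l) = projFreq P k - projFreq P l := by
  ext i
  simp [projFreq, Matrix.mulVec, dotProduct, mul_sub]

/-- The additive map `k ↦ P k`. -/
noncomputable def projFreqHom (P : Matrix (Fin d) (Fin n) ℝ) :
    (Fin n → ℤ) →+ EuclideanSpace ℝ (Fin d) :=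
  AddMonoidHom.ofMapSub (projFreq P) projFreq_sub

theorem IsProjectionMatrix.projFreq_ne_zero (hP : IsProjectionMatrix P) {k : Fin n → ℤ}
    (hk : k ≠ 0) : projFreq P k ≠ 0 := by
  intro h
  have hcomb : ∑ j, (k j : ℚ) • P.col j = 0 := by
    ext i
    have hi : ∑ j, P i j * (k j : ℝ) = 0 := congrArg (fun z : EuclideanSpace ℝ (Fin d) => z i) h
    simpa only [Finset.sum_apply, Pi.smul_apply, Matrix.col_apply, Pi.zero_apply, Rat.smul_def,
      Rat.cast_intCast, mul_comm] using hi
  refine hk (funext fun j => ?_)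
  exact_mod_cast Fintype.linearIndependent_iff.1 hP (fun j => (k j : ℚ)) hcomb j

theorem IsProjectionMatrix.norm_projFreq_pos (hP : IsProjectionMatrix P) (k : NonzeroFreq n) :
    0 < ‖projFreq P k‖ :=
  norm_pos_iff.2 (hP.projFreq_ne_zero k.2)

theorem IsProjectionMatrix.ofReal_norm_projFreq_rpow_ne_zero (hP : IsProjectionMatrix P) (r : ℝ)
    (k : NonzeroFreq n) : ((‖projFreq P k‖ ^ r : ℝ) : ℂ) ≠ 0 :=
  Complex.ofReal_ne_zero.2 (Real.rpow_pos_of_pos (hP.norm_projFreq_pos k) r).ne'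

end ProjFreq

/-! ### The elliptic operator on `ℓ²` -/

section EllipticOp

variable {d n : ℕ}

/-- The symbol `i (P k)ⱼ / |P k|` of the `j`-th component of `P∇` after normalization by the order
one multiplier `|P k|`. -/
noncomputable def rieszSymbol (P : Matrix (Fin d) (Fin n) ℝ) (j : Fin d) : ℓ^∞(NonzeroFreq n, ℂ) :=
  ⟨fun k => Complex.I * (projFreq P k j : ℂ) / ‖projFreq P k‖, memℓp_infty ⟨1, by
    rintro _ ⟨k, rfl⟩
    simp only [norm_div, norm_mul, Complex.norm_I, one_mul, Complex.norm_real, norm_norm]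
    exact div_le_one_of_le₀ (PiLp.norm_apply_le _ j) (norm_nonneg _)⟩⟩

theorem rieszSymbol_apply (P : Matrix (Fin d) (Fin n) ℝ) (j : Fin d) (k : NonzeroFreq n) :
    rieszSymbol P j k = Complex.I * (projFreq P k j : ℂ) / ‖projFreq P k‖ :=
  rfl

theorem norm_rieszSymbol (P : Matrix (Fin d) (Fin n) ℝ) (j : Fin d) (k : NonzeroFreq n) :
    ‖rieszSymbol P j k‖ = ‖projFreq P k j‖ / ‖projFreq P k‖ := by
  rw [rieszSymbol_apply, norm_div, norm_mul, Complex.norm_I, one_mul, Complex.norm_real,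
    Complex.norm_real, norm_norm]

theorem sum_norm_sq_rieszSymbol {P : Matrix (Fin d) (Fin n) ℝ} (hP : IsProjectionMatrix P)
    (k : NonzeroFreq n) : ∑ j, ‖rieszSymbol P j k‖ ^ 2 = 1 := by
  simp only [norm_rieszSymbol, div_pow, ← Finset.sum_div, ← EuclideanSpace.norm_sq_eq]
  exact div_self (pow_pos (hP.norm_projFreq_pos k) 2).ne'

/-- The map sending `w = (|P k| Ûₖ)ₖ` to the `j`-th component of `P∇U`. -/
noncomputable def gradComponent (P : Matrix (Fin d) (Fin n) ℝ) (j : Fin d) :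
    ℓ²(NonzeroFreq n, ℂ) →L[ℂ] Lp ℂ 2 (torusMeasure n) :=
  (fourierSynthesis n).toContinuousLinearMap ∘L diagonalOp (rieszSymbol P j)

theorem norm_gradComponent (P : Matrix (Fin d) (Fin n) ℝ) (j : Fin d) (w : ℓ²(NonzeroFreq n, ℂ)) :
    ‖gradComponent P j w‖ = ‖diagonalOp (rieszSymbol P j) w‖ :=
  (fourierSynthesis n).norm_map _

theorem sum_norm_sq_gradComponent {P : Matrix (Fin d) (Fin n) ℝ} (hP : IsProjectionMatrix P)
    (w : ℓ²(NonzeroFreq n, ℂ)) : ∑ j, ‖gradComponent P j w‖ ^ 2 = ‖w‖ ^ 2 := by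
  simp only [norm_gradComponent]
  refine (hasSum_sum fun j _ => hasSum_norm_sq (diagonalOp (rieszSymbol P j) w)).unique
    ((hasSum_norm_sq w).congr_fun fun k => ?_)
  simp only [diagonalOp_apply, norm_mul, mul_pow, ← Finset.sum_mul, sum_norm_sq_rieszSymbol hP,
    one_mul]

theorem gradComponent_single (P : Matrix (Fin d) (Fin n) ℝ) (j : Fin d) (k : NonzeroFreq n) :
    gradComponent P j (lp.single 2 k 1) = rieszSymbol P j k • charL2 k.1 := by
  have hsingle : diagonalOp (rieszSymbol P j) (lp.single 2 k 1)
      = lp.single 2 k (rieszSymbol P j k) := by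
    ext l
    by_cases h : l = k
    · subst h
      simp [diagonalOp_apply]
    · simp [diagonalOp_apply, h]
  exact (congrArg _ hsingle).trans (fourierSynthesis_single k _)

theorem projGrad_toL2 {P : Matrix (Fin d) (Fin n) ℝ} (hP : IsProjectionMatrix P)
    {U : FourierSeries n} (hU : U 0 = 0) {w : ℓ²(NonzeroFreq n, ℂ)}
    (hw : ∀ k, w k = (‖projFreq P k‖ : ℂ) * U k) (j : Fin d) :
    (projGrad P U j).toL2 = gradComponent P j w := by
  refine toL2_eq_fourierSynthesis (w := diagonalOp (rieszSymbol P j) w)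
    (by rw [projGrad, hU, mul_zero]) fun k => ?_
  have hk : (‖projFreq P k‖ : ℂ) ≠ 0 := Complex.ofReal_ne_zero.2 (hP.norm_projFreq_pos k).ne'
  rw [diagonalOp_apply, rieszSymbol_apply, hw, projGrad, ← mul_assoc, div_mul_cancel₀ _ hk]

/-- The operator on `ℓ²` that represents the elliptic form with coefficient `a` in the coordinates
`w = (|P k| Ûₖ)ₖ` of the energy space. -/
noncomputable def ellipticOp (P : Matrix (Fin d) (Fin n) ℝ) (a : Lp ℂ ∞ (torusMeasure n)) :
    ℓ²(NonzeroFreq n, ℂ) →L[ℂ] ℓ²(NonzeroFreq n, ℂ) :=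
  ∑ j, (gradComponent P j).adjoint ∘L mulL2 a ∘L gradComponent P j

theorem inner_ellipticOp (P : Matrix (Fin d) (Fin n) ℝ) (a : Lp ℂ ∞ (torusMeasure n))
    (u w : ℓ²(NonzeroFreq n, ℂ)) : inner ℂ u (ellipticOp P a w) =
      ∑ j, inner ℂ (gradComponent P j u) (mulL2 a (gradComponent P j w)) := by
  simp only [ellipticOp, sum_apply, inner_sum, ContinuousLinearMap.comp_apply,
    ContinuousLinearMap.adjoint_inner_right]

theorem ellipticOp_coercive {P : Matrix (Fin d) (Fin n) ℝ} (hP : IsProjectionMatrix P)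
    {a : Lp ℂ ∞ (torusMeasure n)} {α : ℝ} (ha : ∀ᵐ y ∂torusMeasure n, α ≤ (a y).re)
    (w : ℓ²(NonzeroFreq n, ℂ)) : α * ‖w‖ ^ 2 ≤ (inner ℂ w (ellipticOp P a w)).re := by
  rw [← sum_norm_sq_gradComponent hP, Finset.mul_sum, inner_ellipticOp, Complex.re_sum]
  exact Finset.sum_le_sum fun j _ => mul_norm_sq_le_re_inner_mulL2 ha _

theorem norm_ellipticOp_single_apply_le {P : Matrix (Fin d) (Fin n) ℝ} (hP : IsProjectionMatrix P)
    {A : Torus n → ℝ} {a : Lp ℂ ∞ (torusMeasure n)}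
    (ha : a =ᵐ[torusMeasure n] fun y => (A y : ℂ)) (k l : NonzeroFreq n) :
    ‖ellipticOp P a (lp.single 2 l 1) k‖ ≤ ‖torusFourierCoeff A (k - l)‖ := by
  have entry : ellipticOp P a (lp.single 2 l 1) k =
      (∑ j, conj (rieszSymbol P j k) * rieszSymbol P j l) * torusFourierCoeff A (k - l) := by
    rw [← inner_single_one, inner_ellipticOp, Finset.sum_mul]
    refine Finset.sum_congr rfl fun j _ => ?_
    rw [gradComponent_single, gradComponent_single, map_smul, inner_smul_left, inner_smul_right,
      inner_charL2_mulL2_charL2 ha, mul_assoc]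
  have symbol_le : ‖∑ j, conj (rieszSymbol P j k) * rieszSymbol P j l‖ ≤ 1 := by
    calc ‖∑ j, conj (rieszSymbol P j k) * rieszSymbol P j l‖
        ≤ ∑ j, ‖rieszSymbol P j k‖ * ‖rieszSymbol P j l‖ := by
          refine norm_sum_le_of_le _ fun j _ => ?_
          rw [norm_mul, RCLike.norm_conj]
      _ ≤ ∑ j, (‖rieszSymbol P j k‖ ^ 2 + ‖rieszSymbol P j l‖ ^ 2) / 2 := by
          refine Finset.sum_le_sum fun j _ => ?_
          linarith [two_mul_le_add_sq ‖rieszSymbol P j k‖ ‖rieszSymbol P j l‖]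
      _ = 1 := by
          rw [← Finset.sum_div, Finset.sum_add_distrib, sum_norm_sq_rieszSymbol hP,
            sum_norm_sq_rieszSymbol hP, one_add_one_eq_two, div_self two_ne_zero]
  rw [entry, norm_mul]
  exact mul_le_of_le_one_left (norm_nonneg _) symbol_le

end EllipticOp

/-! ### Projected Sobolev spaces and the variational problem -/

section Sobolev

variable {d n : ℕ} {P : Matrix (Fin d) (Fin n) ℝ}

theorem mem_HbarP0_iff {U : FourierSeries n} {r : ℝ} : U ∈ HbarP0 P r ↔
    U 0 = 0 ∧ Memℓp (fun k : NonzeroFreq n => ((‖projFreq P k‖ ^ r : ℝ) : ℂ) * U k) 2 := by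
  refine and_congr_right fun _ => ?_
  rw [memℓp_gen_iff (by norm_num)]
  refine summable_congr fun k => ?_
  rw [ENNReal.toReal_ofNat, Real.rpow_two, norm_mul, mul_pow, Complex.norm_real,
    Real.norm_of_nonneg (by positivity), mul_comm 2 r, Real.rpow_mul (norm_nonneg _),
    Real.rpow_two]

/-- The map `U ↦ (|P k|ʳ Ûₖ)ₖ` from the projected Sobolev space of order `r` to `ℓ²`. -/
noncomputable def sobolevMap (P : Matrix (Fin d) (Fin n) ℝ) (r : ℝ) :
    HbarP0 P r →ₗ[ℂ] ℓ²(NonzeroFreq n, ℂ) where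
  toFun U := ⟨_, (mem_HbarP0_iff.1 U.2).2⟩
  map_add' U V := lp.ext (funext fun k => mul_add _ (U.1 k) (V.1 k))
  map_smul' c U := lp.ext (funext fun k => mul_left_comm _ c (U.1 k))

theorem sobolevMap_bijective (hP : IsProjectionMatrix P) (r : ℝ) :
    Function.Bijective (sobolevMap P r) := by
  have hpos := hP.ofReal_norm_projFreq_rpow_ne_zero r
  refine ⟨fun U V hUV => Subtype.ext (funext fun k => ?_), fun w => ?_⟩
  · by_cases hk : k = 0
    · rw [hk, (mem_HbarP0_iff.1 U.2).1, (mem_HbarP0_iff.1 V.2).1]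
    · exact mul_left_cancel₀ (hpos ⟨k, hk⟩) (congrArg (fun w => w ⟨k, hk⟩) hUV)
  · classical
    let U : FourierSeries n := fun k =>
      if h : k ≠ 0 then ((‖projFreq P k‖ ^ r : ℝ) : ℂ)⁻¹ * w ⟨k, h⟩ else 0
    have hw : (fun k : NonzeroFreq n => ((‖projFreq P k‖ ^ r : ℝ) : ℂ) * U k) = w := by
      funext k
      simp only [U, dif_pos k.2]
      exact mul_inv_cancel_left₀ (hpos k) _
    exact ⟨⟨U, mem_HbarP0_iff.2 ⟨dif_neg (not_not.2 rfl), hw ▸ lp.memℓp w⟩⟩, lp.ext hw⟩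

/-- The projected Sobolev space of order `r` identified with `ℓ²` by `U ↦ (|P k|ʳ Ûₖ)ₖ`. -/
noncomputable def sobolevEquiv (hP : IsProjectionMatrix P) (r : ℝ) :
    HbarP0 P r ≃ₗ[ℂ] ℓ²(NonzeroFreq n, ℂ) :=
  LinearEquiv.ofBijective (sobolevMap P r) (sobolevMap_bijective hP r)

theorem sobolevEquiv_apply (hP : IsProjectionMatrix P) {r : ℝ} (U : HbarP0 P r)
    (k : NonzeroFreq n) :
    sobolevEquiv hP r U k = ((‖projFreq P k‖ ^ r : ℝ) : ℂ) * (U : FourierSeries n) k :=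
  rfl

theorem mem_HbarP0_add_iff (hP : IsProjectionMatrix P) {r : ℝ} (U : HbarP0 P r) (t : ℝ) :
    (U : FourierSeries n) ∈ HbarP0 P (r + t) ↔
      Memℓp (fun k : NonzeroFreq n => ((‖projFreq P k‖ ^ t : ℝ) : ℂ) * sobolevEquiv hP r U k)
        2 := by
  rw [mem_HbarP0_iff, and_iff_right (mem_HbarP0_iff.1 U.2).1]
  refine iff_of_eq (congrArg (Memℓp · 2) (funext fun k => ?_))
  rw [sobolevEquiv_apply, Real.rpow_add (hP.norm_projFreq_pos k), Complex.ofReal_mul]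
  ring

theorem dualPairing_eq_inner (hP : IsProjectionMatrix P) {r : ℝ} (F : HbarP0 P (-r))
    (V : HbarP0 P r) : dualPairing (F : FourierSeries n) V =
      inner ℂ (sobolevEquiv hP r V) (sobolevEquiv hP (-r) F) := by
  rw [dualPairing, lp.inner_eq_tsum]
  refine tsum_congr fun k => ?_
  have hk := hP.ofReal_norm_projFreq_rpow_ne_zero r k
  rw [RCLike.inner_apply, sobolevEquiv_apply, sobolevEquiv_apply, map_mul, Complex.conj_ofReal,
    Real.rpow_neg (norm_nonneg _), Complex.ofReal_inv]
  field_simp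

theorem ellipticForm_eq_inner (hP : IsProjectionMatrix P) {A : Torus n → ℝ}
    {a : Lp ℂ ∞ (torusMeasure n)} (ha : a =ᵐ[torusMeasure n] fun y => (A y : ℂ))
    (U V : HbarP0 P 1) : ellipticForm P A (U : FourierSeries n) V =
      inner ℂ (sobolevEquiv hP 1 V) (ellipticOp P a (sobolevEquiv hP 1 U)) := by
  have grad (W : HbarP0 P 1) (j : Fin d) :
      (projGrad P W j).toL2 = gradComponent P j (sobolevEquiv hP 1 W) :=
    projGrad_toL2 hP (mem_HbarP0_iff.1 W.2).1
      (fun k => by rw [sobolevEquiv_apply, Real.rpow_one]) j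
  rw [inner_ellipticOp, ellipticForm]
  refine Finset.sum_congr rfl fun j _ => ?_
  rw [grad, grad, inner_mulL2]
  refine integral_congr_ae ?_
  filter_upwards [ha] with y hy
  rw [hy]

theorem isVariationalSolution_iff (hP : IsProjectionMatrix P) {A : Torus n → ℝ}
    {a : Lp ℂ ∞ (torusMeasure n)} (ha : a =ᵐ[torusMeasure n] fun y => (A y : ℂ))
    (F : HbarP0 P (-1)) (U : HbarP0 P 1) : IsVariationalSolution P A F U ↔
      ellipticOp P a (sobolevEquiv hP 1 U) = sobolevEquiv hP (-1) F := by
  constructor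
  · intro hU
    refine ext_inner_left ℂ fun v => ?_
    obtain ⟨V, rfl⟩ := (sobolevEquiv hP 1).surjective v
    rw [← ellipticForm_eq_inner hP ha, ← dualPairing_eq_inner, hU.2 V V.2]
  · intro hU
    refine ⟨U.2, fun V hV => ?_⟩
    rw [ellipticForm_eq_inner hP ha U ⟨V, hV⟩, hU, ← dualPairing_eq_inner hP F ⟨V, hV⟩]

theorem existsUnique_isVariationalSolution (hP : IsProjectionMatrix P) {A : Torus n → ℝ}
    (hA : AEMeasurable A (torusMeasure n)) {α₀ α₁ : ℝ} (hα₀ : 0 < α₀)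
    (hbound : ∀ᵐ y ∂torusMeasure n, α₀ ≤ A y ∧ A y ≤ α₁) {F : FourierSeries n}
    (hF : F ∈ HbarP0 P (-1)) : ∃! U : FourierSeries n, IsVariationalSolution P A F U := by
  obtain ⟨a, ha, hre⟩ := exists_ae_eq_ofReal_and_le_re hA hbound
  obtain ⟨U, hU, unique⟩ := ((bijective_of_coercive hα₀ (ellipticOp_coercive hP hre)).comp
    (sobolevEquiv hP 1).bijective).existsUnique (sobolevEquiv hP (-1) ⟨F, hF⟩)
  refine ⟨U, (isVariationalSolution_iff hP ha ⟨F, hF⟩ U).2 hU, fun V hV => ?_⟩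
  exact congrArg Subtype.val
    (unique ⟨V, hV.1⟩ ((isVariationalSolution_iff hP ha ⟨F, hF⟩ ⟨V, hV.1⟩).1 hV))

theorem IsVariationalSolution.mem_HbarP0_add_two (hP : IsProjectionMatrix P) {A : Torus n → ℝ}
    (hA : AEMeasurable A (torusMeasure n)) {α₀ α₁ : ℝ} (hα₀ : 0 < α₀)
    (hbound : ∀ᵐ y ∂torusMeasure n, α₀ ≤ A y ∧ A y ≤ α₁) {s : ℝ} (hs : 0 ≤ s)
    (hsum : Summable fun k => (1 + ‖projFreq P k‖) ^ (s + 1) * ‖torusFourierCoeff A k‖)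
    {F U : FourierSeries n} (hF₁ : F ∈ HbarP0 P (-1)) (hFs : F ∈ HbarP0 P s)
    (hU : IsVariationalSolution P A F U) : U ∈ HbarP0 P (s + 2) := by
  classical
  obtain ⟨a, ha, hre⟩ := exists_ae_eq_ofReal_and_le_re hA hbound
  have equation := (isVariationalSolution_iff hP ha ⟨F, hF₁⟩ ⟨U, hU.1⟩).1 hU
  rw [show s = -1 + (s + 1) by ring] at hFs
  rw [show s + 2 = 1 + (s + 1) by ring]
  refine (mem_HbarP0_add_iff hP ⟨U, hU.1⟩ (s + 1)).2 (memℓp_norm_rpow_mul_of_apply hα₀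
    (mul_norm_le_of_coercive (ellipticOp_coercive hP hre)) hs (projFreqHom P)
    Subtype.val_injective hsum (norm_ellipticOp_single_apply_le hP ha) ?_)
  rw [equation]
  exact (mem_HbarP0_add_iff hP ⟨F, hF₁⟩ (s + 1)).1 hFs

end Sobolev

/-! ### Summability of the Fourier coefficients -/

section Decay

variable {d n : ℕ}

/-- The standard lattice `ℤⁿ` of Euclidean space, whose points are the integer frequencies. -/
noncomputable abbrev freqLattice (n : ℕ) : Submodule ℤ (EuclideanSpace ℝ (Fin n)) :=
  Submodule.span ℤ (Set.range (EuclideanSpace.basisFun (Fin n) ℝ).toBasis)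

/-- The indexing of the standard lattice by integer coordinates. -/
noncomputable def freqEquiv (n : ℕ) : (Fin n → ℤ) ≃ₗ[ℤ] freqLattice n :=
  ((EuclideanSpace.basisFun (Fin n) ℝ).toBasis.restrictScalars ℤ).equivFun.symm

theorem coe_freqEquiv (k : Fin n → ℤ) : (freqEquiv n k : EuclideanSpace ℝ (Fin n)) = freq k := by
  rw [freqEquiv, Module.Basis.equivFun_symm_apply, Submodule.coe_sum]
  calc _ = ∑ j, k j • EuclideanSpace.basisFun (Fin n) ℝ j :=
        Finset.sum_congr rfl fun j _ => congrArg (k j • ·) <| by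
          rw [Module.Basis.restrictScalars_apply, OrthonormalBasis.coe_toBasis]
    _ = freq k := by
        ext i
        simp [freq, Pi.single_apply]

theorem norm_freq_pos {k : Fin n → ℤ} (hk : k ≠ 0) : 0 < ‖freq k‖ := by
  rw [← coe_freqEquiv, norm_pos_iff]
  exact fun h => hk ((LinearEquiv.map_eq_zero_iff _).1 (Subtype.ext h))

theorem finrank_freqLattice (n : ℕ) : Module.finrank ℤ (freqLattice n) = n := by
  rw [← (freqEquiv n).finrank_eq, Module.finrank_fin_fun]

theorem summable_one_add_norm_freq_rpow {r : ℝ} (hr : (n : ℝ) < r) :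
    Summable fun k : Fin n → ℤ => (1 + ‖freq k‖) ^ (-r) := by
  have : 0 ≤ r := n.cast_nonneg.trans hr.le
  have hlattice : Summable fun k : Fin n → ℤ => ‖freq k‖ ^ (-r) := by
    have hsum := ZLattice.summable_norm_rpow (freqLattice n) (-r)
      (by rw [finrank_freqLattice]; linarith)
    refine (hsum.comp_injective (freqEquiv n).injective).congr fun k => ?_
    rw [← coe_freqEquiv]
    rfl
  refine hlattice.of_norm_bounded_eventually ?_
  filter_upwards [(Set.finite_singleton (0 : Fin n → ℤ)).compl_mem_cofinite] with k hk
  rw [Real.norm_of_nonneg (by positivity)]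
  exact Real.rpow_le_rpow_of_nonpos (norm_freq_pos hk) (by linarith) (by linarith)

theorem exists_norm_projFreq_le (P : Matrix (Fin d) (Fin n) ℝ) :
    ∃ c, 0 ≤ c ∧ ∀ k : Fin n → ℤ, ‖projFreq P k‖ ≤ c * ‖freq k‖ :=
  ⟨_, norm_nonneg _, fun k => (Matrix.toLpLin 2 2 P).toContinuousLinearMap.le_opNorm (freq k)⟩

theorem HasFourierDecay.summable_projFreq_rpow_mul {A : Torus n → ℝ} {N : ℝ}
    (hdecay : HasFourierDecay A N) (P : Matrix (Fin d) (Fin n) ℝ) {r : ℝ} (hr : 0 ≤ r)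
    (hN : n + r < N) :
    Summable fun k => (1 + ‖projFreq P k‖) ^ r * ‖torusFourierCoeff A k‖ := by
  obtain ⟨C, -, hC⟩ := hdecay
  obtain ⟨c, hc, hPc⟩ := exists_norm_projFreq_le P
  refine ((summable_one_add_norm_freq_rpow (lt_sub_iff_add_lt.2 hN)).mul_left
    ((1 + c) ^ r * C)).of_nonneg_of_le (fun k => by positivity) fun k => ?_
  have hk : 1 + ‖projFreq P k‖ ≤ (1 + c) * (1 + ‖freq k‖) := by
    linarith [hPc k, norm_nonneg (freq k)]
  calc (1 + ‖projFreq P k‖) ^ r * ‖torusFourierCoeff A k‖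
      ≤ ((1 + c) * (1 + ‖freq k‖)) ^ r * (C * (1 + ‖freq k‖) ^ (-N)) := by
        gcongr
        exact hC k
    _ = (1 + c) ^ r * C * (1 + ‖freq k‖) ^ (-(N - r)) := by
        rw [Real.mul_rpow (by positivity) (by positivity), neg_sub, sub_eq_add_neg,
          Real.rpow_add (by positivity)]
        ring

end Decay

theorem corollary3p2_general {d n : ℕ} (P : Matrix (Fin d) (Fin n) ℝ) (hP : IsProjectionMatrix P)
    (A : Torus n → ℝ) (hA : AEMeasurable A (torusMeasure n))
    (α₀ α₁ : ℝ) (hα₀ : 0 < α₀) (hbound : ∀ᵐ y ∂torusMeasure n, α₀ ≤ A y ∧ A y ≤ α₁)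
    (s : ℝ) (hs : 0 ≤ s)
    (hsum : Summable fun k => (1 + ‖projFreq P k‖) ^ (s + 1) * ‖torusFourierCoeff A k‖)
    (F : FourierSeries n) (hF₁ : F ∈ HbarP0 P (-1)) (hFs : F ∈ HbarP0 P s) :
    (∃! U : FourierSeries n, IsVariationalSolution P A F U) ∧
      ∀ U : FourierSeries n, IsVariationalSolution P A F U → U ∈ HbarP0 P (s + 2) :=
  ⟨existsUnique_isVariationalSolution hP hA hα₀ hbound hF₁,
    fun _ hU => hU.mem_HbarP0_add_two hP hA hα₀ hbound hs hsum hF₁ hFs⟩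

theorem corollary3p2 {d n : ℕ} (P : Matrix (Fin d) (Fin n) ℝ) (hP : IsProjectionMatrix P)
    (A : Torus n → ℝ) (hA : AEMeasurable A (torusMeasure n))
    (α₀ α₁ : ℝ) (hα₀ : 0 < α₀) (hbound : ∀ y, α₀ ≤ A y ∧ A y ≤ α₁)
    (s N : ℝ) (hs : 0 ≤ s) (hN : (n : ℝ) + s + 1 < N) (hdecay : HasFourierDecay A N)
    (F : FourierSeries n) (hF₁ : F ∈ HbarP0 P (-1)) (hFs : F ∈ HbarP0 P s) :
    (∃! U : FourierSeries n, IsVariationalSolution P A F U) ∧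
      ∀ U : FourierSeries n, IsVariationalSolution P A F U → U ∈ HbarP0 P (s + 2) :=
  corollary3p2_general P hP A hA α₀ α₁ hα₀ (.of_forall hbound) s hs
    (hdecay.summable_projFreq_rpow_mul P (by linarith) (by linarith)) F hF₁ hFs
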